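/- Let $(W,S)$ be a Coxeter system with $S$ finite, and let $\ell$ be its length function. The (right) weak order on $W$ is the partial order generated by the relations $w<ws$ for $w\in W$, $s\in S$ with $\ell(w)<\ell(ws)$. A reflection is a conjugate of an element of $S$. A cover reflection of $w\in W$ is a reflection $t$ such that $\ell(tw)<\ell(w)$ and $tw=ws$ for some $s\in S$; let $\mathrm{cov}(w)$ be the set of cover reflections of $w$. For subsets $A,B$ of $W$ write $A\le\!\!\!\le B$ if for every $a\in A$ there is $b\in B$ with $a\le b$ in the weak order. A canonical join representation of $w\in W$ is an antichain $A\subseteq W$ in the weak order whose join exists and equals $w$, and such that $A\le\!\!\!\le B$ for every antichain $B\subseteq W$ whose join exists and equals $w$. An element $j\in W$ is join-irreducible if every finite set $X\subseteq W$ whose join exists and equals $j$ contains $j$. Then every $w\in W$ has a unique canonical join representation $A$. The set $A$ is finite, every $j\in A$ is join-irreducible, $\mathrm{cov}(j)$ is a singleton for every $j\in A$, and $\mathrm{cov}(w)$ is the disjoint union of the sets $\mathrm{cov}(j)$ over all $j\in A$. -/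

import Mathlib

section OrderNotions

variable {L : Type*} [PartialOrder L]

/-- The preorder on subsets of a poset: every element of `A` lies below some element of `B`. -/
def JoinRefines (A B : Set L) : Prop :=
  ∀ a ∈ A, ∃ b ∈ B, a ≤ b

/-- `A` is the canonical join representation of `x`: an antichain whose join is `x`, and which
refines every antichain whose join is `x`. (`IsLUB A x` says that the join of `A` exists and is
equal to `x`.) -/
structure IsCanonicalJoinRep (A : Set L) (x : L) : Prop where
  isAntichain : IsAntichain (· ≤ ·) A
  isLUB : IsLUB A x
  refines : ∀ B : Set L, IsAntichain (· ≤ ·) B → IsLUB B x → JoinRefines A B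

/-- `j` is join-irreducible: every finite set whose join is `j` contains `j`. Taking the empty
set, this excludes a least element. -/
def IsJoinIrreducible (j : L) : Prop :=
  ∀ X : Set L, X.Finite → IsLUB X j → j ∈ X

end OrderNotions

namespace CoxeterSystem

variable {B W : Type*} [Group W] {M : CoxeterMatrix B} (cs : CoxeterSystem M W)

/-- The relations `u < u s`, with `s` a simple generator and `ℓ(u) < ℓ(u s)`, that generate the
right weak order. -/
def WeakStep (u v : W) : Prop :=
  ∃ i : B, v = u * cs.simple i ∧ cs.length u < cs.length v

/-- The right weak order: the reflexive transitive closure of the relation `WeakStep`. -/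
def WeakLE (u v : W) : Prop :=
  Relation.ReflTransGen cs.WeakStep u v

theorem WeakLE.eq_or_length_lt {u v : W} (h : cs.WeakLE u v) :
    u = v ∨ cs.length u < cs.length v := by
  induction h with
  | refl => exact Or.inl rfl
  | tail _ hstep ih =>
    obtain ⟨i, -, hlt⟩ := hstep
    rcases ih with rfl | ih
    · exact Or.inr hlt
    · exact Or.inr (ih.trans hlt)

/-- The right weak order, as a partial order on the Coxeter group. -/
@[reducible] def weakOrder : PartialOrder W where
  le := cs.WeakLE
  le_refl _ := Relation.ReflTransGen.refl
  le_trans _ _ _ := Relation.ReflTransGen.trans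
  le_antisymm u v huv hvu := by
    rcases WeakLE.eq_or_length_lt cs huv with h | h
    · exact h
    · rcases WeakLE.eq_or_length_lt cs hvu with h' | h'
      · exact h'.symm
      · exact absurd h (lt_asymm h')

/-- The set of cover reflections of `w`: the inversions `t` of `w`, that is, the reflections with
`ℓ(t w) < ℓ(w)`, such that `t w = w s` for some simple generator `s`. -/
def cov (w : W) : Set W :=
  {t | cs.IsLeftInversion w t ∧ ∃ i : B, t * w = w * cs.simple i}

end CoxeterSystem

namespace CoxeterSystem

variable {B W : Type*} [Group W] {M : CoxeterMatrix B} (cs : CoxeterSystem M W)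

/-! ### The reflection cocycle -/

/-! For each cover reflection t = w s w⁻¹ of w, the elements v ≤ w having t as an inversion have a
least member f(t); the canonical join representation is the image of `cov w` under f.

A lower cover m s of m = f(t) loses only the inversion m s m⁻¹, so by minimality this is t, and `cov
m` is {t}. Hence m has a single lower cover and is join-irreducible. The remaining claims use that w
s keeps every inversion of w except t. If t' ≠ t then f(t') ≤ w s, so f(t') lacks t and is not above
f(t). If u is above all f(t), then so is the meet of u and w, which therefore lies below no w s and
equals w. If the join of C is w and no element of C is above f(t), then no element of C has t as an
inversion, so all lie below w s, which is absurd.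

Meets and the elements f(t) both come from the local criterion `exists_least_of_local`, checked on
rank-two parabolic cosets. Inversions are controlled by the parity cocycle `inversionParity`, which
also yields strong exchange. -/

open Classical in
/-- The action of a simple generator on pairs consisting of a group element and a sign. -/
noncomputable def signedConj (i : B) : Function.End (W × ZMod 2) :=
  fun p ↦ (cs.simple i * p.1 * cs.simple i, p.2 + if p.1 = cs.simple i then 1 else 0)

open Classical in
theorem signedConj_smul (i : B) (t : W) (ε : ZMod 2) :
    cs.signedConj i • (t, ε) =
      (cs.simple i * t * cs.simple i, ε + if t = cs.simple i then 1 else 0) := rfl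

-- Each factor contributes two candidate reflections, hence `2 * k` terms in the sign. For `k = M i
-- j` the second half of the sum repeats the first and cancels mod 2, which gives the braid
-- relations.
open Classical in
theorem signedConj_mul_pow_smul (i j : B) (k : ℕ) (t : W) (ε : ZMod 2) :
    (cs.signedConj i * cs.signedConj j) ^ k • (t, ε) =
      ((cs.simple i * cs.simple j) ^ k * t * ((cs.simple i * cs.simple j) ^ k)⁻¹,
        ε + ∑ l ∈ Finset.range (2 * k),
          if t = cs.simple j * (cs.simple i * cs.simple j) ^ l then 1 else 0) := by
  induction k with
  | zero => simp
  | succ k ih =>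
    rw [pow_succ', mul_smul, ih, mul_smul, signedConj_smul, signedConj_smul]
    set a := cs.simple i with ha
    set b := cs.simple j with hb
    have hai : a⁻¹ = a := cs.inv_simple i
    have hbi : b⁻¹ = b := cs.inv_simple j
    set c := a * b with hc
    have hci : c⁻¹ = b * a := by rw [hc, mul_inv_rev, hai, hbi]
    have hbc : ∀ n : ℕ, (c ^ n)⁻¹ * b = b * c ^ n := by
      intro n
      have h1 : SemiconjBy b c c⁻¹ := by
        rw [SemiconjBy, hci, hc, mul_assoc]
      rw [(h1.pow_right n).eq, inv_pow]
    have key : ∀ x : W, c ^ k * t * (c ^ k)⁻¹ = x ↔ t = (c ^ k)⁻¹ * x * c ^ k := by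
      intro x
      rw [mul_inv_eq_iff_eq_mul, mul_assoc, eq_inv_mul_iff_mul_eq]
    have e1 : (c ^ k * t * (c ^ k)⁻¹ = b) ↔ t = b * c ^ (2 * k) := by
      rw [key, hbc, two_mul, pow_add, mul_assoc]
    have e2 : (b * (c ^ k * t * (c ^ k)⁻¹) * b = a) ↔ t = b * c ^ (2 * k + 1) := by
      have h4 : b * (c ^ k * t * (c ^ k)⁻¹) * b = a ↔ c ^ k * t * (c ^ k)⁻¹ = b * c := by
        generalize c ^ k * t * (c ^ k)⁻¹ = z
        rw [← eq_mul_inv_iff_mul_eq, ← eq_inv_mul_iff_mul_eq, hbi, hc]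
      rw [h4, key, ← mul_assoc, hbc, mul_assoc, mul_assoc, ← pow_succ', ← pow_add]
      congr! 3
      ring
    have e3 : 2 * (k + 1) = 2 * k + 1 + 1 := by ring
    rw [e3, Finset.sum_range_succ, Finset.sum_range_succ]
    simp only [e1, e2]
    refine Prod.ext ?_ ?_
    · simp only [pow_succ' c, mul_inv_rev, hci]
      simp only [hc, mul_assoc]
    · simp only [add_assoc]

theorem isLiftable_signedConj : M.IsLiftable cs.signedConj := by
  classical
  intro i j
  funext ⟨t, ε⟩
  have h := cs.signedConj_mul_pow_smul i j (M i j) t ε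
  have hz : ∀ z : ZMod 2, z + z = 0 := by decide
  have hp := cs.simple_mul_simple_pow i j
  rw [two_mul, Finset.sum_range_add] at h
  simp only [pow_add, hp, one_mul, hz] at h
  have h' : (cs.signedConj i * cs.signedConj j) ^ M i j • (t, ε) = (t, ε) := by
    rw [h]; simp
  exact h'

/-- The action of `W` on pairs consisting of a group element and a sign. -/
noncomputable def signedConjHom : W →* Function.End (W × ZMod 2) :=
  cs.lift ⟨cs.signedConj, cs.isLiftable_signedConj⟩

/-- The parity of the number of occurrences of `t` in the right inversion sequence of any word
for `w`. -/
noncomputable def inversionParity (w t : W) : ZMod 2 := (cs.signedConjHom w • (t, (0 : ZMod 2))).2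

theorem signedConjHom_simple (i : B) : cs.signedConjHom (cs.simple i) = cs.signedConj i :=
  cs.lift_apply_simple _ i

theorem signedConjHom_smul (w t : W) (ε : ZMod 2) :
    cs.signedConjHom w • (t, ε) = (w * t * w⁻¹, ε + cs.inversionParity w t) := by
  classical
  unfold inversionParity
  induction w using cs.simple_induction_left generalizing t ε with
  | one => simp
  | mul_simple_left w i ih =>
    rw [map_mul, mul_smul, mul_smul, ih t ε, ih t 0, signedConjHom_simple, signedConj_smul,
      signedConj_smul]
    simp [mul_assoc, add_assoc]

theorem inversionParity_mul (v w t : W) :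
    cs.inversionParity (v * w) t =
      cs.inversionParity w t + cs.inversionParity v (w * t * w⁻¹) := by
  conv_lhs => rw [inversionParity, map_mul, mul_smul, signedConjHom_smul, signedConjHom_smul]
  simp

open Classical in
theorem inversionParity_simple (i : B) (t : W) :
    cs.inversionParity (cs.simple i) t = if t = cs.simple i then 1 else 0 := by
  rw [inversionParity, signedConjHom_simple, signedConj_smul]
  simp

theorem inversionParity_one (t : W) : cs.inversionParity 1 t = 0 := by
  simp [inversionParity]

theorem mem_rightInvSeq_of_inversionParity_ne_zero (ω : List B) {t : W}
    (h : cs.inversionParity (cs.wordProd ω) t ≠ 0) : t ∈ cs.rightInvSeq ω := by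
  classical
  induction ω with
  | nil => simp [inversionParity_one] at h
  | cons i ω ih =>
    rw [wordProd_cons, inversionParity_mul, inversionParity_simple] at h
    rw [rightInvSeq, List.mem_cons]
    by_cases ht : cs.wordProd ω * t * (cs.wordProd ω)⁻¹ = cs.simple i
    · left
      rw [← ht]; group
    · right
      apply ih
      simpa [ht] using h

theorem IsReflection.inversionParity_self {t : W} (ht : cs.IsReflection t) :
    cs.inversionParity t t = 1 := by
  obtain ⟨w, i, rfl⟩ := ht
  have h1 := cs.inversionParity_mul w⁻¹ w (cs.simple i)
  have h2 : w⁻¹ * (w * cs.simple i * w⁻¹) * w⁻¹⁻¹ = cs.simple i := by group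
  rw [inv_mul_cancel, inversionParity_one] at h1
  rw [inversionParity_mul, inversionParity_mul, h2, inversionParity_simple]
  have h3 : cs.simple i * cs.simple i * (cs.simple i)⁻¹ = cs.simple i := by group
  rw [if_pos rfl, h3, add_left_comm, add_comm (cs.inversionParity _ _), ← h1, add_zero]

/-- Odd parity puts t in the inversion sequence of a reduced word, so t shortens w. If the parity is
even, it is odd for w t, and the same argument shows that t lengthens w. -/
theorem IsReflection.inversionParity_eq_one_iff {t : W} (ht : cs.IsReflection t) (w : W) :
    cs.inversionParity w t = 1 ↔ cs.length (w * t) < cs.length w := by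
  have key : ∀ w, cs.inversionParity w t = 1 → cs.length (w * t) < cs.length w := by
    intro w h
    obtain ⟨ω, hω, rfl⟩ := cs.exists_isReduced w
    exact (cs.isRightInversion_of_mem_rightInvSeq hω
      (cs.mem_rightInvSeq_of_inversionParity_ne_zero ω (by rw [h]; exact one_ne_zero))).2
  refine ⟨key w, fun h ↦ ?_⟩
  by_contra hne
  have h0 : ∀ z : ZMod 2, z ≠ 1 → z = 0 := by decide
  have h1 : cs.inversionParity (w * t) t = 1 := by
    rw [inversionParity_mul, ht.inversionParity_self, mul_inv_cancel_right, h0 _ hne, add_zero]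
  have := key _ h1
  rw [mul_assoc, ht.mul_self, mul_one] at this
  omega

theorem IsReflection.isLeftInversion_iff {t : W} (ht : cs.IsReflection t) (w : W) :
    cs.IsLeftInversion w t ↔ cs.inversionParity w⁻¹ t = 1 := by
  rw [ht.inversionParity_eq_one_iff, ← isRightInversion_inv_iff, IsRightInversion]
  exact and_iff_right ht

theorem IsReflection.conj_inv {t : W} (ht : cs.IsReflection t) (v : W) :
    cs.IsReflection (v⁻¹ * t * v) := by
  simpa using ht.conj v⁻¹

/-- The left inversions of a product form the symmetric difference of the left inversions of the
first factor and the translated left inversions of the second one. -/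
theorem IsReflection.isLeftInversion_mul_iff {t : W} (ht : cs.IsReflection t) (v w : W) :
    cs.IsLeftInversion (v * w) t ↔
      (cs.IsLeftInversion v t ↔ ¬ cs.IsLeftInversion w (v⁻¹ * t * v)) := by
  rw [ht.isLeftInversion_iff, ht.isLeftInversion_iff, (ht.conj_inv cs v).isLeftInversion_iff,
    mul_inv_rev, inversionParity_mul, inv_inv]
  have : ∀ x y : ZMod 2, x + y = 1 ↔ (x = 1 ↔ ¬ y = 1) := by decide
  exact this _ _

theorem IsLeftInversion.mem_leftInvSeq {ω : List B} {t : W}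
    (h : cs.IsLeftInversion (cs.wordProd ω) t) : t ∈ cs.leftInvSeq ω := by
  have h1 := (h.1.isLeftInversion_iff cs _).1 h
  rw [← wordProd_reverse] at h1
  have := cs.mem_rightInvSeq_of_inversionParity_ne_zero ω.reverse
    (t := t) (by rw [h1]; exact one_ne_zero)
  simpa [rightInvSeq_reverse] using this

/-- The strong exchange property. -/
theorem IsLeftInversion.exists_eraseIdx {ω : List B} {t : W}
    (h : cs.IsLeftInversion (cs.wordProd ω) t) :
    ∃ k < ω.length, t * cs.wordProd ω = cs.wordProd (ω.eraseIdx k) := by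
  obtain ⟨k, hk, rfl⟩ := List.mem_iff_getElem.1 h.mem_leftInvSeq
  refine ⟨k, by simpa using hk, ?_⟩
  rw [← getD_leftInvSeq_mul_wordProd, List.getD_eq_getElem _ _ hk]

/-! ### The weak order -/

theorem WeakLE.trans {u v w : W} (huv : cs.WeakLE u v) (hvw : cs.WeakLE v w) : cs.WeakLE u w :=
  Relation.ReflTransGen.trans huv hvw

theorem WeakLE.antisymm {u v : W} (huv : cs.WeakLE u v) (hvu : cs.WeakLE v u) : u = v :=
  cs.weakOrder.le_antisymm u v huv hvu

theorem WeakLE.length_le {u v : W} (h : cs.WeakLE u v) : cs.length u ≤ cs.length v := by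
  rcases h.eq_or_length_lt with rfl | h
  exacts [le_rfl, h.le]

/-- Prefix description of the order: some reduced word of v starts with a reduced word of u. -/
theorem weakLE_iff_length {u v : W} :
    cs.WeakLE u v ↔ cs.length u + cs.length (u⁻¹ * v) = cs.length v := by
  constructor
  · intro h
    induction h with
    | refl => simp
    | tail _ hstep ih =>
      obtain ⟨i, rfl, hlt⟩ := hstep
      rename_i x _
      have h1 := cs.length_mul_simple x i
      have h2 := cs.length_mul_simple (u⁻¹ * x) i
      have h3 := cs.length_mul_le u (u⁻¹ * (x * cs.simple i))
      rw [mul_inv_cancel_left] at h3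
      rw [← mul_assoc] at h3 ⊢
      omega
  · intro h
    induction hn : cs.length (u⁻¹ * v) generalizing v with
    | zero =>
      rw [length_eq_zero_iff, inv_mul_eq_one] at hn
      subst hn
      exact Relation.ReflTransGen.refl
    | succ n ih =>
      have hne : u⁻¹ * v ≠ 1 := by
        rw [ne_eq, ← cs.length_eq_zero_iff]; omega
      obtain ⟨i, hi⟩ := cs.exists_rightDescent_of_ne_one hne
      have hi' := cs.isRightDescent_iff.1 hi
      rw [mul_assoc] at hi'
      have h1 := cs.length_mul_simple v i
      have h2 := cs.length_mul_le u (u⁻¹ * (v * cs.simple i))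
      rw [mul_inv_cancel_left] at h2
      refine Relation.ReflTransGen.tail (ih (v := v * cs.simple i) (by omega) (by omega)) ?_
      exact ⟨i, by simp, by omega⟩

theorem weakLE_mul_iff {u v : W} :
    cs.WeakLE u (u * v) ↔ cs.length (u * v) = cs.length u + cs.length v := by
  rw [weakLE_iff_length, inv_mul_cancel_left, eq_comm]

theorem one_weakLE (w : W) : cs.WeakLE 1 w := by simp [weakLE_iff_length]

theorem simple_weakLE_iff {i : B} {w : W} :
    cs.WeakLE (cs.simple i) w ↔ cs.IsLeftDescent w i := by
  rw [weakLE_iff_length, isLeftDescent_iff, length_simple, inv_simple, add_comm]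

theorem IsRightDescent.weakLE {w : W} {i : B} (h : cs.IsRightDescent w i) :
    cs.WeakLE (w * cs.simple i) w :=
  Relation.ReflTransGen.single ⟨i, by simp, h⟩

theorem IsLeftInversion.of_weakLE {u v t : W} (ht : cs.IsLeftInversion u t)
    (h : cs.WeakLE u v) : cs.IsLeftInversion v t := by
  refine ⟨ht.1, ?_⟩
  have h1 := (cs.weakLE_iff_length).1 h
  have h2 := cs.length_mul_le (t * u) (u⁻¹ * v)
  have h3 := ht.2
  rw [mul_assoc, mul_inv_cancel_left] at h2
  omega

/-- If `u ≤ w` then `v ↦ u v` identifies `[1, u⁻¹ w]` with `[u, w]`. -/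
theorem WeakLE.mul_weakLE_iff {u w : W} (h : cs.WeakLE u w) {a : W} :
    cs.WeakLE u (u * a) ∧ cs.WeakLE (u * a) w ↔ cs.WeakLE a (u⁻¹ * w) := by
  rw [weakLE_mul_iff, weakLE_iff_length, weakLE_iff_length]
  rw [weakLE_iff_length] at h
  have h1 := cs.length_mul_le u a
  have h2 := cs.length_mul_le (u * a) ((u * a)⁻¹ * w)
  have h3 := cs.length_mul_le a (a⁻¹ * (u⁻¹ * w))
  rw [mul_inv_cancel_left] at h2 h3
  rw [mul_inv_rev, mul_assoc] at *
  omega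

theorem exists_rightDescent_of_weakLE {u w : W} (h : cs.WeakLE u w) (hne : u ≠ w) :
    ∃ i, cs.IsRightDescent w i ∧ cs.WeakLE u (w * cs.simple i) := by
  rcases Relation.ReflTransGen.cases_tail h with rfl | ⟨v, huv, i, rfl, hlt⟩
  · exact absurd rfl hne
  · exact ⟨i, by simpa [IsRightDescent] using hlt, by rw [simple_mul_simple_cancel_right]; exact huv⟩

theorem isLeftInversion_mul_simple_conj {w : W} {i : B} :
    cs.IsLeftInversion w (w * cs.simple i * w⁻¹) ↔ cs.IsRightDescent w i := by
  rw [IsLeftInversion, IsRightDescent, inv_mul_cancel_right]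
  exact and_iff_right ⟨w, i, rfl⟩

/-- An element below `w` is below the lower cover `w s` as soon as the cover reflection
`w s w⁻¹` is not one of its inversions. -/
theorem WeakLE.weakLE_mul_simple {b w : W} {i : B} (h : cs.WeakLE b w)
    (hi : cs.IsRightDescent w i) (ht : ¬ cs.IsLeftInversion b (w * cs.simple i * w⁻¹)) :
    cs.WeakLE b (w * cs.simple i) := by
  have h1 := cs.isLeftInversion_mul_simple_conj.2 hi
  have hr : cs.IsReflection (w * cs.simple i * w⁻¹) := ⟨w, i, rfl⟩
  have h2 := hr.isLeftInversion_mul_iff cs b (b⁻¹ * w)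
  rw [mul_inv_cancel_left] at h2
  have h3 : cs.IsLeftInversion (b⁻¹ * w) (b⁻¹ * (w * cs.simple i * w⁻¹) * b) := by tauto
  have h4 := h3.2
  have h5 : b⁻¹ * (w * cs.simple i * w⁻¹) * b * (b⁻¹ * w) = b⁻¹ * (w * cs.simple i) := by group
  rw [h5] at h4
  rw [weakLE_iff_length] at h ⊢
  have h6 := cs.isRightDescent_iff.1 hi
  have h7 := cs.length_mul_le b (b⁻¹ * (w * cs.simple i))
  rw [mul_inv_cancel_left] at h7
  omega

/-- The inversions of a lower cover. -/
theorem IsRightDescent.isLeftInversion_iff {w t : W} {i : B} (hi : cs.IsRightDescent w i) :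
    cs.IsLeftInversion (w * cs.simple i) t ↔
      cs.IsLeftInversion w t ∧ t ≠ w * cs.simple i * w⁻¹ := by
  have hne : ∀ t, t = w * cs.simple i * w⁻¹ → ¬ cs.IsLeftInversion (w * cs.simple i) t := by
    rintro t rfl h
    have := h.2
    rw [← mul_assoc, inv_mul_cancel_right, simple_mul_simple_cancel_right] at this
    exact lt_asymm this hi
  refine ⟨fun h ↦ ⟨h.of_weakLE cs hi.weakLE, fun h' ↦ hne t h' h⟩, fun ⟨h, h'⟩ ↦ ?_⟩
  rw [h.1.isLeftInversion_mul_iff]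
  refine iff_of_true h fun h2 ↦ h' ?_
  have h3 := h2.2
  rw [length_simple, Nat.lt_one_iff, length_eq_zero_iff] at h3
  have h4 := eq_inv_of_mul_eq_one_left h3
  rw [inv_simple] at h4
  rw [← h4]; group

/-! ### Elements of standard parabolic subgroups -/

/-- `w` is a product of simple generators indexed by `J`. -/
def IsWordIn (J : Set B) (w : W) : Prop := ∃ ω : List B, (∀ i ∈ ω, i ∈ J) ∧ cs.wordProd ω = w

theorem IsWordIn.mul {J : Set B} {u v : W} (hu : cs.IsWordIn J u) (hv : cs.IsWordIn J v) :
    cs.IsWordIn J (u * v) := by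
  obtain ⟨ω, hω, rfl⟩ := hu
  obtain ⟨ω', hω', rfl⟩ := hv
  refine ⟨ω ++ ω', ?_, cs.wordProd_append _ _⟩
  intro i hi
  rcases List.mem_append.1 hi with h | h
  exacts [hω i h, hω' i h]

theorem IsWordIn.inv {J : Set B} {u : W} (hu : cs.IsWordIn J u) : cs.IsWordIn J u⁻¹ := by
  obtain ⟨ω, hω, rfl⟩ := hu
  exact ⟨ω.reverse, by simpa using hω, cs.wordProd_reverse _⟩

theorem isWordIn_simple {J : Set B} {i : B} (hi : i ∈ J) : cs.IsWordIn J (cs.simple i) :=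
  ⟨[i], by simpa using hi, by simp⟩

theorem isWordIn_one (J : Set B) : cs.IsWordIn J 1 := ⟨[], by simp, by simp⟩

theorem IsWordIn.of_isLeftInversion {J : Set B} {u t : W} (hu : cs.IsWordIn J u)
    (ht : cs.IsLeftInversion u t) : cs.IsWordIn J t := by
  have hu' := hu
  obtain ⟨ω, hω, rfl⟩ := hu
  obtain ⟨k, -, hk⟩ := ht.exists_eraseIdx
  rw [eq_mul_inv_of_mul_eq hk]
  exact IsWordIn.mul cs ⟨_, fun i hi ↦ hω i (List.mem_of_mem_eraseIdx hi), rfl⟩ (hu'.inv cs)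

/-- If the first letter is not a descent, strong exchange gives a shorter word for u, still with
letters in J. -/
theorem IsWordIn.exists_isLeftDescent {J : Set B} {u : W} (hu : cs.IsWordIn J u) (h1 : u ≠ 1) :
    ∃ i ∈ J, cs.IsLeftDescent u i := by
  obtain ⟨ω, hω, rfl⟩ := hu
  induction hn : ω.length using Nat.strong_induction_on generalizing ω with
  | _ n ih =>
    cases ω with
    | nil => simp at h1
    | cons i ω =>
      by_cases hd : cs.IsLeftDescent (cs.wordProd (i :: ω)) i
      · exact ⟨i, hω i (by simp), hd⟩
      · rw [wordProd_cons, ← isLeftDescent_iff_not_isLeftDescent_mul,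
          ← isLeftInversion_simple_iff_isLeftDescent] at hd
        obtain ⟨k, hk, he⟩ := hd.exists_eraseIdx
        rw [wordProd_cons, he] at h1 ⊢
        refine ih (ω.eraseIdx k).length ?_ (ω.eraseIdx k)
          (fun j hj ↦ hω j (List.mem_cons_of_mem _ (List.mem_of_mem_eraseIdx hj))) h1 rfl
        rw [← hn, List.length_eraseIdx_of_lt hk, List.length_cons]
        omega

/-- The inversion s of a = u (u⁻¹ a) does not come from u, so it comes from u⁻¹ a, which u⁻¹ s u
therefore shortens. -/
theorem WeakLE.simple_mul {u a : W} {i : B} (h : cs.WeakLE u a) (hu : ¬ cs.IsLeftDescent u i)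
    (ha : cs.IsLeftDescent a i) : cs.WeakLE (cs.simple i * u) a := by
  have hr := cs.isReflection_simple i
  have h2 := hr.isLeftInversion_mul_iff cs u (u⁻¹ * a)
  rw [mul_inv_cancel_left, isLeftInversion_simple_iff_isLeftDescent,
    isLeftInversion_simple_iff_isLeftDescent] at h2
  have h3 : cs.IsLeftInversion (u⁻¹ * a) (u⁻¹ * cs.simple i * u) := by tauto
  have h4 := h3.2
  have h5 : u⁻¹ * cs.simple i * u * (u⁻¹ * a) = (cs.simple i * u)⁻¹ * a := by simp [mul_assoc]
  rw [h5] at h4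
  rw [weakLE_iff_length] at h ⊢
  have h6 := cs.not_isLeftDescent_iff.1 hu
  have h7 := cs.length_mul_le (cs.simple i * u) ((cs.simple i * u)⁻¹ * a)
  rw [mul_inv_cancel_left] at h7
  omega

/-- If all elements of `J` are left descents of `a`, then all of the parabolic subgroup generated
by `J` is below `a`. -/
theorem IsWordIn.weakLE {J : Set B} {u a : W} (hu : cs.IsWordIn J u)
    (ha : ∀ i ∈ J, cs.IsLeftDescent a i) : cs.WeakLE u a := by
  induction hn : cs.length u using Nat.strong_induction_on generalizing u with
  | _ n ih =>
    by_cases h1 : u = 1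
    · rw [h1]; exact cs.one_weakLE a
    · obtain ⟨i, hi, hd⟩ := hu.exists_isLeftDescent cs h1
      have := ih _ (hn ▸ hd) ((cs.isWordIn_simple hi).mul cs hu) rfl
      simpa using this.simple_mul cs (cs.isLeftDescent_iff_not_isLeftDescent_mul.1 hd) (ha i hi)

/-- The longest element of a parabolic subgroup below `x`. -/
theorem exists_longest {J : Set B} {x : W} (hx : ∀ i ∈ J, cs.IsLeftDescent x i) :
    ∃ a, cs.IsWordIn J a ∧ ∀ i ∈ J, cs.IsLeftDescent a i := by
  classical
  have hb : ∀ n, (∃ u, cs.IsWordIn J u ∧ cs.length u = n) → n ≤ cs.length x := by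
    rintro _ ⟨u, hu, rfl⟩
    exact (hu.weakLE cs hx).length_le
  -- Lengths in the parabolic subgroup are bounded by that of x; take a of maximal length.
  obtain ⟨a, ha, hal⟩ := Nat.findGreatest_spec (P := fun n ↦ ∃ u, cs.IsWordIn J u ∧ cs.length u = n)
    (Nat.zero_le (cs.length x)) ⟨1, cs.isWordIn_one J, cs.length_one⟩
  refine ⟨a, ha, fun i hi ↦ ?_⟩
  by_contra hd
  rw [not_isLeftDescent_iff] at hd
  have hs : ∃ u, cs.IsWordIn J u ∧ cs.length u = cs.length a + 1 :=
    ⟨_, (cs.isWordIn_simple hi).mul cs ha, hd⟩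
  have := Nat.le_findGreatest (P := fun n ↦ ∃ u, cs.IsWordIn J u ∧ cs.length u = n)
    (hb _ hs) hs
  omega

end CoxeterSystem


/-- A local confluence criterion for the existence of a least element: `step z x` means that `z`
is a lower cover of `x`. -/
theorem exists_least_of_local {α : Type*} (le : α → α → Prop) (refl : ∀ x, le x x)
    (trans : ∀ {x y z}, le x y → le y z → le x z) (antisymm : ∀ {x y}, le x y → le y x → x = y)
    (P : α → Prop) (top : α) (hP : P top) (htop : ∀ x, P x → le x top) (rank : α → ℕ)
    (step : α → α → Prop)
    (hstep : ∀ x y, P x → P y → le y x → y ≠ x →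
      ∃ z, P z ∧ step z x ∧ le y z ∧ le z x ∧ rank z < rank x)
    (hlocal : ∀ x y z, P x → P y → P z → step y x → step z x → ∃ v, P v ∧ le v y ∧ le v z) :
    ∃ m, P m ∧ ∀ x, P x → le m x := by
  have key : ∀ n x, rank x = n → P x → ∃ m, P m ∧ le m x ∧ ∀ v, P v → le v x → le m v := by
    intro n
    induction n using Nat.strong_induction_on with
    | _ n ih =>
      rintro x rfl hx
      by_cases hmin : ∀ y, P y → le y x → y = x
      · exact ⟨x, hx, refl x, fun v hv hvx ↦ hmin v hv hvx ▸ refl v⟩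
      · push Not at hmin
        obtain ⟨y₀, hy₀, hy₀x, hne⟩ := hmin
        obtain ⟨y, hy, hyx, -, hle, hr⟩ := hstep x y₀ hx hy₀ hy₀x hne
        obtain ⟨m, hm, hmy, hml⟩ := ih _ hr y rfl hy
        refine ⟨m, hm, trans hmy hle, fun v hv hvx ↦ ?_⟩
        by_cases hvx' : v = x
        · exact hvx' ▸ trans hmy hle
        · obtain ⟨z, hz, hzx, hvz, hlez, hrz⟩ := hstep x v hx hv hvx hvx'
          obtain ⟨m', hm', hmz, hml'⟩ := ih _ hrz z rfl hz
          -- The common lower bound p forces the least elements below y and below z to coincide.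
          obtain ⟨p, hp, hpy, hpz⟩ := hlocal x y z hx hy hz hyx hzx
          have h1 : le m p := hml p hp hpy
          have h2 : le m' p := hml' p hp hpz
          have h3 : m = m' :=
            antisymm (hml m' hm' (trans h2 hpy)) (hml' m hm (trans h1 hpz))
          exact h3 ▸ hml' v hv hvz
  obtain ⟨m, hm, -, h⟩ := key _ top rfl hP
  exact ⟨m, hm, fun x hx ↦ h x hx (htop x hx)⟩

namespace CoxeterSystem

variable {B W : Type*} [Group W] {M : CoxeterMatrix B} (cs : CoxeterSystem M W)

/-! ### Meets in the weak order -/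

theorem WeakLE.mul_left_of_isWordIn {J : Set B} {v a w : W} (hvw : cs.WeakLE v w)
    (hw : ∀ i ∈ J, cs.WeakLE v (v * cs.simple i) ∧ cs.WeakLE (v * cs.simple i) w)
    (ha : cs.IsWordIn J a) : cs.WeakLE v (v * a) ∧ cs.WeakLE (v * a) w := by
  rw [hvw.mul_weakLE_iff]
  refine ha.weakLE cs fun i hi ↦ ?_
  rw [← simple_weakLE_iff, ← hvw.mul_weakLE_iff]
  exact hw i hi

/-- The criterion is applied to the reversed order: two upper covers x s_i, x s_j below u and w lie
below x a, with a longest in the parabolic subgroup of {i, j}. -/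
theorem exists_meet (u w : W) :
    ∃ z, cs.WeakLE z u ∧ cs.WeakLE z w ∧ ∀ v, cs.WeakLE v u → cs.WeakLE v w → cs.WeakLE v z := by
  have := exists_least_of_local (fun x y ↦ cs.WeakLE y x) (fun x ↦ Relation.ReflTransGen.refl)
    (fun h h' ↦ h'.trans cs h) (fun h h' ↦ h'.antisymm cs h)
    (fun v ↦ cs.WeakLE v u ∧ cs.WeakLE v w) 1 ⟨cs.one_weakLE u, cs.one_weakLE w⟩
    (fun x _ ↦ cs.one_weakLE x) (fun v ↦ cs.length w - cs.length v)
    (fun z x ↦ cs.WeakStep x z) ?_ ?_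
  · obtain ⟨m, ⟨h1, h2⟩, h3⟩ := this
    exact ⟨m, h1, h2, fun v hu hw ↦ h3 v ⟨hu, hw⟩⟩
  · rintro x y - ⟨hyu, hyw⟩ hxy hne
    rcases Relation.ReflTransGen.cases_head hxy with rfl | ⟨z, hxz, hzy⟩
    · exact absurd rfl hne
    · refine ⟨z, ⟨hzy.trans hyu, hzy.trans hyw⟩, hxz, hzy, Relation.ReflTransGen.single hxz, ?_⟩
      have h1 : cs.length z ≤ cs.length w := WeakLE.length_le cs (hzy.trans hyw)
      obtain ⟨i, -, h2⟩ := hxz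
      omega
  · rintro x y z ⟨hxu, hxw⟩ ⟨hyu, hyw⟩ ⟨hzu, hzw⟩ ⟨i, rfl, hi⟩ ⟨j, rfl, hj⟩
    have hx : ∀ k ∈ ({i, j} : Set B), cs.WeakLE x (x * cs.simple k) ∧
        cs.WeakLE (x * cs.simple k) u ∧ cs.WeakLE (x * cs.simple k) w := by
      rintro k (rfl | rfl)
      · exact ⟨Relation.ReflTransGen.single ⟨k, rfl, hi⟩, hyu, hyw⟩
      · exact ⟨Relation.ReflTransGen.single ⟨k, rfl, hj⟩, hzu, hzw⟩
    have hd : ∀ k ∈ ({i, j} : Set B), cs.IsLeftDescent (x⁻¹ * u) k := by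
      intro k hk
      rw [← simple_weakLE_iff, ← hxu.mul_weakLE_iff]
      exact ⟨(hx k hk).1, (hx k hk).2.1⟩
    obtain ⟨a, ha, had⟩ := cs.exists_longest hd
    have hau := hxu.mul_left_of_isWordIn cs (fun k hk ↦ ⟨(hx k hk).1, (hx k hk).2.1⟩) ha
    have haw := hxw.mul_left_of_isWordIn cs (fun k hk ↦ ⟨(hx k hk).1, (hx k hk).2.2⟩) ha
    have hk : ∀ k ∈ ({i, j} : Set B), cs.WeakLE (x * cs.simple k) (x * a) := by
      intro k hk
      refine (((hau.1).mul_weakLE_iff cs).2 ?_).2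
      rw [inv_mul_cancel_left, simple_weakLE_iff]
      exact had k hk
    exact ⟨x * a, ⟨hau.2, haw.2⟩, hk i (by simp), hk j (by simp)⟩

/-! ### The least element below `w` with a given cover reflection as an inversion -/

/-- If `a` is the longest element of a parabolic subgroup, conjugation by `a` permutes the simple
generators of that subgroup. -/
theorem IsWordIn.exists_conj_simple {J : Set B} {a : W} (ha : cs.IsWordIn J a)
    (had : ∀ i ∈ J, cs.IsLeftDescent a i) {k : B} (hk : k ∈ J) :
    ∃ l ∈ J, a * cs.simple k * a⁻¹ = cs.simple l := by
  have h1 := (ha.mul cs (cs.isWordIn_simple hk)).weakLE cs had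
  have h2 := h1.length_le
  have hz : cs.IsWordIn J (a * cs.simple k * a⁻¹) :=
    (ha.mul cs (cs.isWordIn_simple hk)).mul cs (ha.inv cs)
  have hr : cs.IsReflection (a * cs.simple k * a⁻¹) := ⟨a, k, rfl⟩
  -- The conjugate z satisfies ℓ(z) + ℓ(a s_k) = ℓ(a), and ℓ(a s_k) = ℓ(a) - 1, so z has length one.
  have h3 := hz.weakLE cs had
  rw [weakLE_iff_length, hr.inv, inv_mul_cancel_right] at h3
  have h4 := cs.length_mul_simple a k
  obtain ⟨l, hl, hd⟩ := hz.exists_isLeftDescent cs (fun h ↦ by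
    have := hr.odd_length
    rw [h, length_one] at this
    simp at this)
  refine ⟨l, hl, ?_⟩
  have h5 : cs.length (cs.simple l * (a * cs.simple k * a⁻¹)) = 0 := by
    rw [IsLeftDescent] at hd
    omega
  rw [length_eq_zero_iff] at h5
  rw [eq_inv_of_mul_eq_one_right h5, inv_simple]

theorem IsWordIn.inv_eq_self_of_longest {J : Set B} {a : W} (ha : cs.IsWordIn J a)
    (had : ∀ i ∈ J, cs.IsLeftDescent a i) : a⁻¹ = a := by
  have h := (cs.weakLE_iff_length).1 ((ha.inv cs).weakLE cs had)
  rw [length_inv, Nat.add_eq_left, length_eq_zero_iff, inv_inv] at h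
  exact inv_eq_of_mul_eq_one_left h

theorem exists_least_of_mem_cov {w t : W} (ht : t ∈ cs.cov w) :
    ∃ m, (cs.WeakLE m w ∧ cs.IsLeftInversion m t) ∧
      ∀ v, cs.WeakLE v w ∧ cs.IsLeftInversion v t → cs.WeakLE m v := by
  obtain ⟨htw, i₀, hi₀⟩ := ht
  have hd₀ : cs.IsRightDescent w i₀ := by rw [IsRightDescent, ← hi₀]; exact htw.2
  have ht₀ : t = w * cs.simple i₀ * w⁻¹ := eq_mul_inv_of_mul_eq hi₀
  refine exists_least_of_local cs.WeakLE (fun x ↦ Relation.ReflTransGen.refl)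
    (fun h h' ↦ h.trans cs h') (fun h h' ↦ h.antisymm cs h')
    (fun v ↦ cs.WeakLE v w ∧ cs.IsLeftInversion v t) w ⟨Relation.ReflTransGen.refl, htw⟩
    (fun x hx ↦ hx.1) cs.length
    (fun z x ↦ ∃ i, cs.IsRightDescent x i ∧ z = x * cs.simple i) ?_ ?_
  · rintro x y ⟨hxw, -⟩ ⟨-, hyt⟩ hyx hne
    obtain ⟨i, hi, hy⟩ := cs.exists_rightDescent_of_weakLE hyx hne
    exact ⟨x * cs.simple i, ⟨hi.weakLE.trans cs hxw, hyt.of_weakLE cs hy⟩, ⟨i, hi, rfl⟩, hy,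
      hi.weakLE, hi⟩
  · rintro v _ _ ⟨hvw, hvt⟩ ⟨-, hyt⟩ ⟨-, hzt⟩ ⟨i, hi, rfl⟩ ⟨j, hj, rfl⟩
    have hJ : ∀ k ∈ ({i, j} : Set B), cs.IsRightDescent v k ∧
        cs.IsLeftInversion (v * cs.simple k) t := by
      rintro k (rfl | rfl)
      exacts [⟨hi, hyt⟩, ⟨hj, hzt⟩]
    have hd : ∀ k ∈ ({i, j} : Set B), cs.IsLeftDescent v⁻¹ k := fun k hk ↦
      (cs.isLeftDescent_inv_iff).2 (hJ k hk).1
    obtain ⟨a, ha, had⟩ := cs.exists_longest hd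
    have hav : ∀ b, cs.IsWordIn {i, j} b → cs.length b + cs.length (v * b) = cs.length v := by
      intro b hb
      have := (cs.weakLE_iff_length).1 (hb.weakLE cs hd)
      rwa [← mul_inv_rev, length_inv, length_inv] at this
    have hva := hav a ha
    have hai := ha.inv_eq_self_of_longest cs had
    have haa : a * a = 1 := inv_eq_iff_mul_eq_one.1 hai
    -- v a is the bottom of the coset of v, hence the candidate lower bound. It remains to see that
    -- t is still an inversion of it.
    have hv₀ : ∀ b, cs.IsWordIn {i, j} b → cs.WeakLE (v * a) (v * a * b) := by
      intro b hb
      rw [weakLE_mul_iff, mul_assoc]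
      have h1 := hav _ (ha.mul cs hb)
      have h2 := (cs.weakLE_iff_length).1 (hb.weakLE cs had)
      rw [← length_inv _ (b⁻¹ * a), mul_inv_rev, inv_inv, hai] at h2
      omega
    have hvk : ∀ k ∈ ({i, j} : Set B), cs.WeakLE (v * a) (v * cs.simple k) := by
      intro k hk
      have := hv₀ _ ((ha.inv cs).mul cs (cs.isWordIn_simple hk))
      simpa [mul_assoc] using this
    refine ⟨v * a, ⟨?_, ?_⟩, hvk i (by simp), hvk j (by simp)⟩
    · exact ((hvk i (by simp)).trans cs hi.weakLE).trans cs hvw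
    by_contra hnt
    set v₀ := v * a with hv₀_def
    have hv₀v : cs.WeakLE v₀ v := (hvk i (by simp)).trans cs hi.weakLE
    have hv : v₀ * a = v := by rw [hv₀_def, mul_assoc, haa, mul_one]
    have hra : cs.IsLeftInversion a (v₀⁻¹ * t * v₀) := by
      have := hvt.1.isLeftInversion_mul_iff cs v₀ a
      rw [hv] at this
      tauto
    have hrJ := ha.of_isLeftInversion cs hra
    -- The reflections v₀ s_k v₀⁻¹ are inversions of w other than t, so they survive in w s.
    have hx : ∀ k ∈ ({i, j} : Set B), cs.IsLeftDescent (v₀⁻¹ * (w * cs.simple i₀)) k := by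
      intro k hk
      have h1 : cs.WeakLE v₀ (v₀ * cs.simple k) ∧ cs.WeakLE (v₀ * cs.simple k) v := by
        rw [hv₀v.mul_weakLE_iff, simple_weakLE_iff, inv_mul_eq_of_eq_mul hv.symm]
        exact had k hk
      have hlt : cs.length v₀ < cs.length (v₀ * cs.simple k) := by
        have := h1.1.length_le
        have := cs.length_mul_simple v₀ k
        omega
      set τ := v₀ * cs.simple k * v₀⁻¹ with hτ
      have hτr : cs.IsReflection τ := ⟨v₀, k, rfl⟩
      have hτv₀ : τ * v₀ = v₀ * cs.simple k := by rw [hτ, inv_mul_cancel_right]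
      have hτn : ¬ cs.IsLeftInversion v₀ τ := fun h ↦ by
        have := h.2
        rw [hτv₀] at this
        omega
      have hτk : cs.IsLeftInversion (v₀ * cs.simple k) τ := by
        refine ⟨hτr, ?_⟩
        rw [← hτv₀, ← mul_assoc, hτr.mul_self, one_mul, hτv₀]
        exact hlt
      have hτw : cs.IsLeftInversion w τ := hτk.of_weakLE cs (h1.2.trans cs hvw)
      -- Conjugation by a turns τ into v s_l v⁻¹, the inversion lost in passing to v s_l; but t is
      -- kept there.
      have hne : τ ≠ t := by
        rintro rfl
        obtain ⟨l, hl, hal⟩ := ha.exists_conj_simple cs had hk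
        refine (((hJ l hl).1.isLeftInversion_iff cs).1 (hJ l hl).2).2 ?_
        rw [hτ, ← hal, hv₀_def]
        simp only [mul_inv_rev, mul_assoc]
      rw [ht₀] at hne
      have h2 := (hd₀.isLeftInversion_iff cs).2 ⟨hτw, hne⟩
      have h3 := hτr.isLeftInversion_mul_iff cs v₀ (v₀⁻¹ * (w * cs.simple i₀))
      have h4 : v₀⁻¹ * τ * v₀ = cs.simple k := by rw [hτ]; group
      rw [mul_inv_cancel_left, h4, isLeftInversion_simple_iff_isLeftDescent] at h3
      tauto
    -- The whole parabolic subgroup, including the reflection v₀⁻¹ t v₀, lies below v₀⁻¹ w s. This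
    -- makes t an inversion of w s, a contradiction.
    have hr : cs.IsLeftInversion (v₀⁻¹ * t * v₀) (v₀⁻¹ * t * v₀) := by
      refine ⟨hra.1, ?_⟩
      rw [hra.1.mul_self, length_one]
      exact hra.1.odd_length.pos
    have hrx := hr.of_weakLE cs (hrJ.weakLE cs hx)
    have h5 := hvt.1.isLeftInversion_mul_iff cs v₀ (v₀⁻¹ * (w * cs.simple i₀))
    rw [mul_inv_cancel_left, hd₀.isLeftInversion_iff] at h5
    tauto

/-! ### Canonical join representations -/

/-- A least element `m` among the elements below `w` having the cover reflection `t` of `w` as an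
inversion has `t` as its only cover reflection. -/
theorem cov_eq_singleton {w t m : W} (hm : cs.WeakLE m w ∧ cs.IsLeftInversion m t)
    (hmin : ∀ v, cs.WeakLE v w ∧ cs.IsLeftInversion v t → cs.WeakLE m v) : cs.cov m = {t} := by
  have key : ∀ i, cs.IsRightDescent m i → t = m * cs.simple i * m⁻¹ := by
    intro i hi
    by_contra hne
    have := hmin _ ⟨hi.weakLE.trans cs hm.1, (hi.isLeftInversion_iff cs).2 ⟨hm.2, hne⟩⟩
    exact absurd this.length_le (not_le.2 hi)
  have h1 : m ≠ 1 := by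
    rintro rfl
    have := hm.2.2
    simp at this
  ext r
  constructor
  · rintro ⟨hr, i, hi⟩
    have hd : cs.IsRightDescent m i := by rw [IsRightDescent, ← hi]; exact hr.2
    rw [Set.mem_singleton_iff, key i hd]
    exact eq_mul_inv_of_mul_eq hi
  · rintro rfl
    obtain ⟨i, hi⟩ := cs.exists_rightDescent_of_ne_one h1
    exact ⟨hm.2, i, by rw [key i hi, inv_mul_cancel_right]⟩

/-- The only lower cover of j is t j, so it bounds every set of elements strictly below j. -/
theorem isJoinIrreducible_of_cov_eq_singleton {j t : W} (h : cs.cov j = {t}) :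
    letI : PartialOrder W := cs.weakOrder
    IsJoinIrreducible j := by
  let _ : PartialOrder W := cs.weakOrder
  intro X _ hX
  by_contra hj
  have ht : t ∈ cs.cov j := h ▸ rfl
  obtain ⟨htj, i, hi⟩ := ht
  have hd : cs.IsRightDescent j i := by rw [IsRightDescent, ← hi]; exact htj.2
  have hub : cs.WeakLE j (j * cs.simple i) := by
    refine hX.2 fun x hx ↦ ?_
    obtain ⟨k, hk, hxk⟩ := cs.exists_rightDescent_of_weakLE (hX.1 hx)
      (fun h ↦ hj (h ▸ hx))
    have h1 : j * cs.simple k * j⁻¹ ∈ cs.cov j :=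
      ⟨cs.isLeftInversion_mul_simple_conj.2 hk, k, by rw [inv_mul_cancel_right]⟩
    rw [h, Set.mem_singleton_iff] at h1
    have h2 : t * j = j * cs.simple k := by rw [← h1, inv_mul_cancel_right]
    change cs.WeakLE x (j * cs.simple i)
    rwa [← hi, h2]
  exact absurd hub.length_le (not_le.2 hd)

end CoxeterSystem

theorem IsCanonicalJoinRep.unique {L : Type*} [PartialOrder L] {A A' : Set L} {x : L}
    (h : IsCanonicalJoinRep A x) (h' : IsCanonicalJoinRep A' x) : A' = A := by
  have key : ∀ {A A' : Set L}, IsCanonicalJoinRep A x → IsCanonicalJoinRep A' x → A ⊆ A' := by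
    intro A A' h h' a ha
    obtain ⟨b, hb, hab⟩ := h.refines A' h'.isAntichain h'.isLUB a ha
    obtain ⟨c, hc, hbc⟩ := h'.refines A h.isAntichain h.isLUB b hb
    have hac := h.isAntichain.eq ha hc (hab.trans hbc)
    exact (le_antisymm hab (hac ▸ hbc)) ▸ hb
  exact (key h' h).antisymm (key h h')

theorem theoremW {B W : Type*} [Finite B] [Group W] {M : CoxeterMatrix B}
    (cs : CoxeterSystem M W) (w : W) :
    letI : PartialOrder W := cs.weakOrder
    ∃ A : Set W,
      IsCanonicalJoinRep A w ∧
      (∀ A' : Set W, IsCanonicalJoinRep A' w → A' = A) ∧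
      A.Finite ∧
      (∀ j ∈ A, IsJoinIrreducible j) ∧
      (∀ j ∈ A, ∃ t, cs.cov j = {t}) ∧
      A.PairwiseDisjoint cs.cov ∧
      cs.cov w = ⋃ j ∈ A, cs.cov j := by
  let _ : PartialOrder W := cs.weakOrder
  choose! f hf hmin using fun t (ht : t ∈ cs.cov w) ↦ cs.exists_least_of_mem_cov ht
  have hcov : ∀ t ∈ cs.cov w, cs.cov (f t) = {t} := fun t ht ↦
    cs.cov_eq_singleton (hf t ht) (hmin t ht)
  have hdesc : ∀ t ∈ cs.cov w, ∃ i, cs.IsRightDescent w i ∧ t = w * cs.simple i * w⁻¹ := by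
    rintro t ⟨ht, i, hi⟩
    exact ⟨i, by rw [CoxeterSystem.IsRightDescent, ← hi]; exact ht.2, eq_mul_inv_of_mul_eq hi⟩
  have hmem : ∀ i, cs.IsRightDescent w i → w * cs.simple i * w⁻¹ ∈ cs.cov w := fun i hi ↦
    ⟨cs.isLeftInversion_mul_simple_conj.2 hi, i, by rw [inv_mul_cancel_right]⟩
  have hcan : IsCanonicalJoinRep (f '' cs.cov w) w := by
    refine ⟨?_, ⟨?_, ?_⟩, ?_⟩
    · rintro _ ⟨t, ht, rfl⟩ _ ⟨t', ht', rfl⟩ hne hle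
      have htt' : t' ≠ t := fun h ↦ hne (h ▸ rfl)
      obtain ⟨i, hi, rfl⟩ := hdesc t ht
      have h1 := (hi.isLeftInversion_iff cs).2 ⟨ht'.1, htt'⟩
      have h2 := hmin t' ht' _ ⟨hi.weakLE, h1⟩
      exact ((hi.isLeftInversion_iff cs).1 (((hf _ ht).2.of_weakLE cs hle).of_weakLE cs h2)).2 rfl
    · rintro _ ⟨t, ht, rfl⟩
      exact (hf t ht).1
    · intro u hu
      obtain ⟨z, hzu, hzw, hz⟩ := cs.exists_meet u w
      by_cases hne : z = w
      · exact hne ▸ hzu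
      · obtain ⟨i, hi, hzi⟩ := cs.exists_rightDescent_of_weakLE hzw hne
        have hm := hmem i hi
        have h1 := hz _ (hu ⟨_, hm, rfl⟩) (hf _ hm).1
        have h2 := ((hf _ hm).2.of_weakLE cs h1).of_weakLE cs hzi
        exact absurd rfl ((hi.isLeftInversion_iff cs).1 h2).2
    · rintro C - hC _ ⟨t, ht, rfl⟩
      by_contra! hlt
      obtain ⟨i, hi, rfl⟩ := hdesc t ht
      have hub : cs.WeakLE w (w * cs.simple i) := hC.2 fun b hb ↦
        CoxeterSystem.WeakLE.weakLE_mul_simple cs (hC.1 hb) hi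
          fun h ↦ hlt b hb (hmin _ ht b ⟨hC.1 hb, h⟩)
      exact absurd hub.length_le (not_le.2 hi)
  refine ⟨f '' cs.cov w, hcan, fun A' hA' ↦ hcan.unique hA', ?_, ?_, ?_, ?_, ?_⟩
  · refine Set.Finite.image _ ((Set.finite_range fun i ↦ w * cs.simple i * w⁻¹).subset ?_)
    intro t ht
    obtain ⟨i, -, rfl⟩ := hdesc t ht
    exact ⟨i, rfl⟩
  · rintro _ ⟨t, ht, rfl⟩
    exact cs.isJoinIrreducible_of_cov_eq_singleton (hcov t ht)
  · rintro _ ⟨t, ht, rfl⟩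
    exact ⟨t, hcov t ht⟩
  · rintro _ ⟨t, ht, rfl⟩ _ ⟨t', ht', rfl⟩ hne
    rw [Function.onFun, hcov t ht, hcov t' ht', Set.disjoint_singleton]
    rintro rfl
    exact hne rfl
  · ext t
    simp only [Set.mem_iUnion, Set.mem_image, exists_prop]
    constructor
    · intro ht
      exact ⟨f t, ⟨t, ht, rfl⟩, by rw [hcov t ht]; rfl⟩
    · rintro ⟨_, ⟨t', ht', rfl⟩, h⟩
      rw [hcov t' ht', Set.mem_singleton_iff] at h
      exact h ▸ ht'
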